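/- Let $L$ be a countable first-order language and let $G$ be a group in the language $L$, that is, an $L$-structure with a group operation whose graph is defined by an $L$-formula $\mu(x,y,z)$ without parameters (so $G$ may carry additional structure). Let $\mathfrak C$ be a monster model of $\mathrm{Th}(G)$, that is, for some $\kappa>\aleph_0$ a $\kappa$-saturated and strongly $\kappa$-homogeneous $L$-structure elementarily equivalent to $G$; sets of cardinality $<\kappa$ are called small. A global type $\mathfrak p$ is an ultrafilter on the Boolean algebra of subsets of $\mathfrak C$ definable with parameters; $\mathfrak p|_B$ denotes its restriction to the sets definable over $B$. A non-algebraic global type $\mathfrak p$ (one containing no finite set) is called strongly regular if for some small $A\subseteq\mathfrak C$ it is invariant under all automorphisms of $\mathfrak C$ fixing $A$ pointwise and, for all $B$ with $A\subseteq B\subseteq\mathfrak C$ and all $a\in\mathfrak C$, either $a\models\mathfrak p|_B$ or $\mathfrak p|_B\vdash\mathfrak p|_{B\cup\{a\}}$. Suppose that $G$ is regular, i.e. that $\mathfrak C$ carries a strongly regular global type. Then there is an $L$-structure $H$, elementarily equivalent to $G$, in which $\mu$ defines the graph of a group operation, and which is quasiminimal: $H$ is uncountable, and every subset of $H$ that is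 definable with parameters is countable or cocountable. -/

import Mathlib

open FirstOrder Cardinal

universe u v w w'

namespace RegularGroups

/-- An `L`-structure is quasiminimal if it is uncountable and each of its subsets that is definable
with parameters is countable or cocountable. -/
def IsQuasiminimal (L : FirstOrder.Language.{u, v}) (M : Type w) [L.Structure M] : Prop :=
  Uncountable M ∧
    ∀ X : Set M, (Set.univ : Set M).Definable₁ L X → X.Countable ∨ Xᶜ.Countable

/-- The formula `μ` (without parameters) defines the graph of the multiplication of `G`, so that
`G` is a group in the language `L`, possibly with additional structure. -/
def DefinesMul {L : FirstOrder.Language.{u, v}} (μ : L.Formula (Fin 3)) (G : Type w) [Group G]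
    [L.Structure G] : Prop :=
  ∀ a b c : G, μ.Realize ![a, b, c] ↔ a * b = c

/-- `C` is `κ`-saturated: for every parameter set `B` of cardinality `< κ`, every finitely
satisfiable set of formulas in one variable over `B` (given by the subsets of `C` which they define)
is satisfied by one element of `C`. -/
def IsSaturated (L : FirstOrder.Language.{u, v}) (κ : Cardinal.{w}) (C : Type w) [L.Structure C] : Prop :=
  ∀ B : Set C, #B < κ → ∀ S : Set (Set C), (∀ X ∈ S, B.Definable₁ L X) →
    (∀ F : Set (Set C), F ⊆ S → F.Finite → (⋂₀ F).Nonempty) → (⋂₀ S).Nonempty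

/-- A map from a set `B` of elements of `C` to `C` is elementary if it preserves the truth of all
`L`-formulas. (The elements of `B` serve as the variables of the formulas.) -/
def IsPartialElementary (L : FirstOrder.Language.{u, v}) {C : Type w} [L.Structure C] {B : Set C}
    (f : B → C) : Prop :=
  ∀ φ : L.Formula B, φ.Realize (fun b : B => (b : C)) ↔ φ.Realize f

/-- `C` is strongly `κ`-homogeneous: every elementary map between subsets of `C` of
cardinality `< κ` extends to an automorphism of `C`. -/
def IsStronglyHomogeneous (L : FirstOrder.Language.{u, v}) (κ : Cardinal.{w}) (C : Type w)
    [L.Structure C] : Prop :=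
  ∀ B : Set C, #B < κ → ∀ f : B → C, IsPartialElementary L f →
    ∃ σ : C ≃[L] C, ∀ b : B, σ b = f b

/-- `C` is a monster model (of its complete theory, in a countable language `L`), where "small"
means "of cardinality `< κ`". -/
structure IsMonster (L : FirstOrder.Language.{u, v}) (κ : Cardinal.{w}) (C : Type w) [L.Structure C] :
    Prop where
  aleph0_lt : ℵ₀ < κ
  saturated : IsSaturated L κ C
  homogeneous : IsStronglyHomogeneous L κ C

/-- A global type in one variable: an ultrafilter on the Boolean algebra of the subsets of `C`
which are definable with parameters. -/
structure GlobalType (L : FirstOrder.Language.{u, v}) (C : Type w) [L.Structure C] where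
  /-- the definable sets that belong to the type -/
  sets : Set (Set C)
  definable : ∀ X ∈ sets, (Set.univ : Set C).Definable₁ L X
  univ_mem : Set.univ ∈ sets
  empty_notMem : ∅ ∉ sets
  inter_mem : ∀ X ∈ sets, ∀ Y ∈ sets, X ∩ Y ∈ sets
  mem_of_superset : ∀ X ∈ sets, ∀ Y : Set C, (Set.univ : Set C).Definable₁ L Y → X ⊆ Y → Y ∈ sets
  mem_or_compl_mem : ∀ Y : Set C, (Set.univ : Set C).Definable₁ L Y → Y ∈ sets ∨ Yᶜ ∈ sets

namespace GlobalType

variable {L : FirstOrder.Language.{u, v}} {C : Type w} [L.Structure C]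

/-- The restriction `p|_B` of a global type `p` to a set `B` of parameters. -/
def restrict (p : GlobalType L C) (B : Set C) : Set (Set C) :=
  {X | X ∈ p.sets ∧ B.Definable₁ L X}

/-- The element `a` realizes `p|_B`. -/
def Realizes (p : GlobalType L C) (B : Set C) (a : C) : Prop :=
  ∀ X ∈ p.restrict B, a ∈ X

/-- `p|_B ⊢ p|_B'`, modulo the elementary diagram of `C`: every formula in `p|_B'` is implied in `C`
by a formula in `p|_B` (recall that `p|_B` is closed under conjunctions). -/
def Entails (p : GlobalType L C) (B B' : Set C) : Prop :=
  ∀ Y ∈ p.restrict B', ∃ X ∈ p.restrict B, X ⊆ Y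

/-- `p` is `A`-invariant: it is preserved by all automorphisms of `C` that fix `A` pointwise. -/
def IsInvariant (p : GlobalType L C) (A : Set C) : Prop :=
  ∀ σ : C ≃[L] C, (∀ a ∈ A, σ a = a) → ∀ X ∈ p.sets, σ '' X ∈ p.sets

/-- `p` is not algebraic: it contains no formula with finitely many solutions. -/
def IsNonalgebraic (p : GlobalType L C) : Prop :=
  ∀ X ∈ p.sets, X.Infinite

/-- The pair `(p, x = x)` is strongly regular over `A`. -/
structure IsStronglyRegular (p : GlobalType L C) (A : Set C) : Prop where
  nonalgebraic : p.IsNonalgebraic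
  invariant : p.IsInvariant A
  regular : ∀ B : Set C, A ⊆ B → ∀ a : C, p.Realizes B a ∨ p.Entails B (insert a B)

end GlobalType

/-- Some global type in one variable is strongly regular over a small (for instance, empty) set of
parameters. -/
def CarriesStronglyRegularType (L : FirstOrder.Language.{u, v}) (κ : Cardinal.{w}) (C : Type w)
    [L.Structure C] : Prop :=
  ∃ (p : GlobalType L C) (A : Set C), #A < κ ∧ p.IsStronglyRegular A

end RegularGroups

/-! Let `p` be strongly regular. In a group, a definable set `X` lies in `p` exactly when the
quotients of elements of `X` exhaust the group (`mem_iff`), so membership in `p` is definable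
without parameters, uniformly in families. Regularity and saturation give, for definable `X` outside
`p` and definable `R`, one `Y` in `p` that decides `R(x, e)` for all `e` in `X` at once
(`exists_decides`). As membership in `p` is definable, the parameters of `Y` can be moved into any
elementary substructure `M` of the monster, even one that does not contain `A` (`decidesOver`).

For countable `M` let `cl M` be the union of the `M`-definable sets outside `p`. Adjoin a
realization `a` of `p|_M`: every set definable over `M` and `a` that meets `cl M` already meets `M`.
An omitting-types construction inside the monster preserves this property while closing off to a
countable elementary `N`, so `N` is a proper extension of `M` with `N ∩ cl M ⊆ M`
(`exists_extension`).

A maximal chain of such extensions has an uncountable union `H`, since a countable union could be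
extended once more. A set definable over `H` and outside `p` is definable over a countable member
`M` of the chain, and its trace on `H` lies in `M`. As `p` is an ultrafilter, every definable subset
of `H` is countable or cocountable. -/

namespace RegularGroups

/-! ### Calculus of definable predicates and parameters -/

section DefinablePredicates

variable {L : FirstOrder.Language.{u, v}} {C : Type w} [L.Structure C] {A B : Set C}

/-- A predicate on tuples is definable over `A`. -/
def DefPred (L : FirstOrder.Language.{u, v}) {C : Type w} [L.Structure C] (A : Set C) {ι : Type*}
    (P : (ι → C) → Prop) : Prop :=
  A.Definable L {x : ι → C | P x}

namespace DefPred

variable {ι : Type*} {P Q : (ι → C) → Prop}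

theorem and (hP : DefPred L A P) (hQ : DefPred L A Q) : DefPred L A fun x => P x ∧ Q x :=
  Set.Definable.inter hP hQ

theorem or (hP : DefPred L A P) (hQ : DefPred L A Q) : DefPred L A fun x => P x ∨ Q x :=
  Set.Definable.union hP hQ

theorem not (hP : DefPred L A P) : DefPred L A fun x => ¬ P x :=
  Set.Definable.compl hP

theorem imp (hP : DefPred L A P) (hQ : DefPred L A Q) : DefPred L A fun x => P x → Q x := by
  simpa only [imp_iff_not_or] using hP.not.or hQ

theorem ex {R : (ι → C) → C → Prop}
    (h : DefPred L A fun y : Option ι → C => R (y ∘ some) (y none)) :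
    DefPred L A fun x => ∃ a, R x a := by
  have h' := Set.Definable.exists_of_finite (α := ι) (β := Unit)
    (Set.Definable.preimage_comp (fun o : Option ι => o.elim (Sum.inr ()) Sum.inl) h)
  refine (congrArg (A.Definable L) ?_).mp h'
  ext x
  constructor
  · rintro ⟨y, hy⟩
    exact ⟨y (), hy⟩
  · rintro ⟨a, ha⟩
    exact ⟨fun _ => a, ha⟩

theorem all {R : (ι → C) → C → Prop}
    (h : DefPred L A fun y : Option ι → C => R (y ∘ some) (y none)) :
    DefPred L A fun x => ∀ a, R x a := by
  simpa only [not_exists, not_not] using (ex (R := fun x a => ¬ R x a) h.not).not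

theorem of_definable₁ {X : Set C} (h : A.Definable₁ L X) (i : ι) :
    DefPred L A fun x : ι → C => x i ∈ X :=
  Set.Definable.preimage_comp (fun _ : Fin 1 => i) h

theorem of_definable₂ {X : Set (C × C)} (h : A.Definable₂ L X) (i j : ι) :
    DefPred L A fun x : ι → C => (x i, x j) ∈ X :=
  Set.Definable.preimage_comp (![i, j] : Fin 2 → ι) h

theorem of_formula {α : Type*} (φ : L.Formula α) (f : α → ι) :
    DefPred L A fun x : ι → C => φ.Realize (x ∘ f) := by
  have h : (∅ : Set C).Definable L {x : ι → C | φ.Realize (x ∘ f)} := by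
    rw [Set.empty_definable_iff]
    refine ⟨φ.relabel f, ?_⟩
    ext x
    simp [Language.Formula.realize_relabel]
  exact Set.Definable.mono h (Set.empty_subset A)

theorem subst {R : (ι → C) → C → Prop} {a : C} (ha : a ∈ A)
    (h : DefPred L A fun y : Option ι → C => R (y ∘ some) (y none)) :
    DefPred L A fun x => R x a := by
  have h' : DefPred L A fun x : ι → C => ∃ b, b ∈ ({a} : Set C) ∧ R x b :=
    ex (R := fun x b => b ∈ ({a} : Set C) ∧ R x b)
      ((of_definable₁ (Set.Definable.singleton_of_mem L ha) none).and h)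
  simpa using h'

end DefPred

theorem exists_finset_definable₁ {X : Set C} (h : A.Definable₁ L X) :
    ∃ F : Finset C, (F : Set C) ⊆ A ∧ (F : Set C).Definable₁ L X :=
  Set.definable_iff_finitely_definable.mp h

theorem exists_finset_definable₂ {X : Set (C × C)} (h : A.Definable₂ L X) :
    ∃ F : Finset C, (F : Set C) ⊆ A ∧ (F : Set C).Definable₂ L X :=
  Set.definable_iff_finitely_definable.mp h

theorem definable₁_mono {X : Set C} (h : A.Definable₁ L X) (hAB : A ⊆ B) : B.Definable₁ L X :=
  Set.Definable.mono h hAB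

theorem definable₂_mono {X : Set (C × C)} (h : A.Definable₂ L X) (hAB : A ⊆ B) :
    B.Definable₂ L X :=
  Set.Definable.mono h hAB

theorem definable₁_compl {X : Set C} (h : A.Definable₁ L X) : A.Definable₁ L Xᶜ :=
  Set.Definable.compl h

theorem definable₁_inter {X Y : Set C} (h : A.Definable₁ L X) (h' : A.Definable₁ L Y) :
    A.Definable₁ L (X ∩ Y) :=
  Set.Definable.inter h h'

theorem definable₁_fiber {R : Set (C × C)} (h : A.Definable₂ L R) {a : C} (ha : a ∈ A) :
    A.Definable₁ L {x | (x, a) ∈ R} :=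
  DefPred.subst (R := fun (x : Fin 1 → C) a => (x 0, a) ∈ R) ha
    (DefPred.of_definable₂ h (some 0) none)

/-- The parameter `e` is turned into a second variable, except where it already belongs to `A`. -/
theorem exists_fiber {X : Set C} {e : C} (h : (insert e A).Definable₁ L X) :
    ∃ R : Set (C × C), A.Definable₂ L R ∧ X = {x | (x, e) ∈ R} := by
  classical
  obtain ⟨φ, hφ⟩ := Set.definable_iff_exists_formula_sum.mp h
  let g : ↥(insert e A) ⊕ Fin 1 → A ⊕ Fin 2 :=
    Sum.elim (fun b => if hb : (b : C) ∈ A then Sum.inl ⟨b, hb⟩ else Sum.inr 1) fun _ => Sum.inr 0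
  let ψ : L.Formula (A ⊕ Fin 2) := φ.relabel g
  refine ⟨{q | ψ.Realize (Sum.elim (fun a : A => (a : C)) ![q.1, q.2])}, ?_, ?_⟩
  · refine Set.definable_iff_exists_formula_sum.mpr ⟨ψ, ?_⟩
    ext x
    have : ![x 0, x 1] = x := by ext i; fin_cases i <;> rfl
    simp [this]
  · ext x
    have hx : x ∈ X ↔ (fun _ : Fin 1 => x) ∈ {x : Fin 1 → C | x 0 ∈ X} := Iff.rfl
    rw [hx, hφ]
    simp only [Set.mem_ofPred_eq, ψ, Language.Formula.realize_relabel]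
    refine iff_of_eq (congrArg _ ?_)
    ext (b | i)
    · by_cases hb : (b : C) ∈ A
      · simp [g, hb]
      · have : (b : C) = e := b.2.resolve_right hb
        simp [g, this, this ▸ hb]
    · simp [g]

theorem countable_setOf_definable₁ [Countable L.Symbols] (hA : A.Countable) :
    {X : Set C | A.Definable₁ L X}.Countable := by
  have := hA.to_subtype
  refine (Set.countable_range fun φ : L[[A]].Formula (Fin 1) =>
    {x : C | φ.Realize fun _ => x}).mono ?_
  rintro X ⟨φ, hφ⟩
  refine ⟨φ, ?_⟩
  ext x
  have hx : x ∈ X ↔ (fun _ : Fin 1 => x) ∈ {x : Fin 1 → C | x 0 ∈ X} := Iff.rfl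
  rw [hx, hφ]
  rfl

theorem countable_setOf_definable₂ [Countable L.Symbols] (hA : A.Countable) :
    {X : Set (C × C) | A.Definable₂ L X}.Countable := by
  have := hA.to_subtype
  refine (Set.countable_range fun φ : L[[A]].Formula (Fin 2) =>
    {x : C × C | φ.Realize ![x.1, x.2]}).mono ?_
  rintro X ⟨φ, hφ⟩
  refine ⟨φ, ?_⟩
  ext x
  have hx : x ∈ X ↔ ![x.1, x.2] ∈ {x : Fin 2 → C | (x 0, x 1) ∈ X} := Iff.rfl
  rw [hx, hφ]
  rfl

/-- By the Tarski–Vaught test `M` is an elementary substructure, so the existence of a solution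
tuple, being first-order over `M`, passes down to `M`. -/
theorem meetsDefinable_tuple {M : Set C} (hM : L.MeetsDefinable M) {ι : Type*} [Finite ι]
    {P : (ι → C) → Prop} (hP : DefPred L M P) (hne : ∃ x, P x) :
    ∃ x : ι → C, (∀ i, x i ∈ M) ∧ P x := by
  let S := hM.toElementarySubstructure
  have hS : (S : Set C) = M := hM.closure_eq_self
  have hP' : DefPred L (S : Set C) P := hS.symm ▸ hP
  obtain ⟨φ, hφ⟩ := Set.definable_iff_exists_formula_sum.mp hP'
  have key : ∀ x, P x ↔ φ.Realize (Sum.elim (fun a : (S : Set C) => (a : C)) x) := fun x =>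
    Set.ext_iff.mp hφ x
  obtain ⟨x, hx⟩ := hne
  have h1 : (φ.iExs ι).Realize (S.subtype ∘ (id : S → S)) :=
    Language.Formula.realize_iExs.mpr ⟨x, (key x).mp hx⟩
  rw [S.subtype.map_formula] at h1
  obtain ⟨y, hy⟩ := Language.Formula.realize_iExs.mp h1
  refine ⟨fun i => y i, fun i => hS ▸ (y i).2, (key _).mpr ?_⟩
  rw [← S.subtype.map_formula] at hy
  refine (iff_of_eq (congrArg _ ?_)).mp hy
  ext (b | i) <;> rfl

end DefinablePredicates

end RegularGroups

namespace RegularGroups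

/-! ### Transfer of the group structure along elementary equivalence -/

section GroupTransfer

variable {L : FirstOrder.Language.{u, v}} {G : Type w} {K : Type w'} [L.Structure G]
  [L.Structure K]

theorem exists_group_of_elementarilyEquivalent [Group G] {μ : L.Formula (Fin 3)}
    (hμ : DefinesMul μ G) (h : L.ElementarilyEquivalent G K) :
    ∃ _ : Group K, DefinesMul μ K := by
  have tr : ∀ φ : L.Sentence, φ.Realize G ↔ φ.Realize K := fun φ => by
    have := Set.ext_iff.mp h φ
    simpa [Language.completeTheory] using this
  have hμ' : ∀ f : Fin 3 → G, μ.Realize f ↔ f 0 * f 1 = f 2 := fun f => by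
    rw [← hμ]
    exact iff_of_eq (congrArg _ (by ext i; fin_cases i <;> rfl))
  have htot : ∀ a b : K, ∃ c, μ.Realize ![a, b, c] := by
    let φ : L.Sentence := Language.Formula.iAlls (Fin 2) (Language.Formula.iExs Unit
      (μ.relabel ![Sum.inl (Sum.inr 0), Sum.inl (Sum.inr 1), Sum.inr ()]))
    have hG : φ.Realize G := by
      simp only [φ, Language.Sentence.Realize, Language.Formula.realize_iAlls,
        Language.Formula.realize_iExs, Language.Formula.realize_relabel, hμ']
      exact fun x => ⟨fun _ => x 0 * x 1, rfl⟩
    have hK := (tr φ).mp hG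
    simp only [φ, Language.Sentence.Realize, Language.Formula.realize_iAlls,
      Language.Formula.realize_iExs, Language.Formula.realize_relabel] at hK
    intro a b
    obtain ⟨c, hc⟩ := hK ![a, b]
    refine ⟨c (), (iff_of_eq (congrArg _ ?_)).mp hc⟩
    ext i; fin_cases i <;> rfl
  have huniq : ∀ a b c d : K, μ.Realize ![a, b, c] → μ.Realize ![a, b, d] → c = d := by
    let φ : L.Sentence := Language.Formula.iAlls (Fin 4) ((μ.relabel
      ![Sum.inr 0, Sum.inr 1, Sum.inr 2]).imp ((μ.relabel ![Sum.inr 0, Sum.inr 1, Sum.inr 3]).imp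
        (Language.Term.equal (Language.Term.var (Sum.inr 2)) (Language.Term.var (Sum.inr 3)))))
    have hG : φ.Realize G := by
      simp only [φ, Language.Sentence.Realize, Language.Formula.realize_iAlls,
        Language.Formula.realize_imp, Language.Formula.realize_relabel, hμ',
        Language.Formula.realize_equal]
      exact fun x h1 h2 => h1.symm.trans h2
    have hK := (tr φ).mp hG
    simp only [φ, Language.Sentence.Realize, Language.Formula.realize_iAlls,
      Language.Formula.realize_imp, Language.Formula.realize_relabel,
      Language.Formula.realize_equal] at hK
    intro a b c d h1 h2
    refine hK ![a, b, c, d] ((iff_of_eq (congrArg _ ?_)).mp h1) ((iff_of_eq (congrArg _ ?_)).mp h2)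
      <;> (ext i; fin_cases i <;> rfl)
  have hassoc : ∀ a b c ab bc x : K, μ.Realize ![a, b, ab] → μ.Realize ![b, c, bc] →
      μ.Realize ![ab, c, x] → μ.Realize ![a, bc, x] := by
    let φ : L.Sentence := Language.Formula.iAlls (Fin 6) ((μ.relabel
      ![Sum.inr 0, Sum.inr 1, Sum.inr 3]).imp ((μ.relabel ![Sum.inr 1, Sum.inr 2, Sum.inr 4]).imp
        ((μ.relabel ![Sum.inr 3, Sum.inr 2, Sum.inr 5]).imp
          (μ.relabel ![Sum.inr 0, Sum.inr 4, Sum.inr 5]))))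
    have hG : φ.Realize G := by
      simp only [φ, Language.Sentence.Realize, Language.Formula.realize_iAlls,
        Language.Formula.realize_imp, Language.Formula.realize_relabel, hμ']
      intro x (h1 : x 0 * x 1 = x 3) (h2 : x 1 * x 2 = x 4) (h3 : x 3 * x 2 = x 5)
      change x 0 * x 4 = x 5
      rw [← h2, ← h3, ← h1, mul_assoc]
    have hK := (tr φ).mp hG
    simp only [φ, Language.Sentence.Realize, Language.Formula.realize_iAlls,
      Language.Formula.realize_imp, Language.Formula.realize_relabel] at hK
    intro a b c ab bc x h1 h2 h3
    refine (iff_of_eq (congrArg _ ?_)).mp (hK ![a, b, c, ab, bc, x]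
      ((iff_of_eq (congrArg _ ?_)).mp h1) ((iff_of_eq (congrArg _ ?_)).mp h2)
      ((iff_of_eq (congrArg _ ?_)).mp h3)) <;> (ext i; fin_cases i <;> rfl)
  have hone : ∃ e : K, ∀ a, μ.Realize ![e, a, a] ∧ ∃ b, μ.Realize ![b, a, e] := by
    let φ : L.Sentence := Language.Formula.iExs Unit (Language.Formula.iAlls Unit
      ((μ.relabel ![Sum.inl (Sum.inr ()), Sum.inr (), Sum.inr ()]) ⊓ Language.Formula.iExs Unit
        (μ.relabel ![Sum.inr (), Sum.inl (Sum.inr ()), Sum.inl (Sum.inl (Sum.inr ()))])))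
    have hG : φ.Realize G := by
      simp only [φ, Language.Sentence.Realize, Language.Formula.realize_iAlls,
        Language.Formula.realize_iExs, Language.Formula.realize_inf,
        Language.Formula.realize_relabel, hμ']
      exact ⟨fun _ => 1, fun x => ⟨one_mul (x ()), fun _ => (x ())⁻¹, inv_mul_cancel (x ())⟩⟩
    have hK := (tr φ).mp hG
    simp only [φ, Language.Sentence.Realize, Language.Formula.realize_iAlls,
      Language.Formula.realize_iExs, Language.Formula.realize_inf,
      Language.Formula.realize_relabel] at hK
    obtain ⟨e, he⟩ := hK
    refine ⟨e (), fun a => ?_⟩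
    obtain ⟨h1, b, h2⟩ := he fun _ => a
    refine ⟨(iff_of_eq (congrArg _ ?_)).mp h1, b (), (iff_of_eq (congrArg _ ?_)).mp h2⟩ <;>
      (ext i; fin_cases i <;> rfl)
  choose m hm using htot
  obtain ⟨e, he⟩ := hone
  choose he1 inv hinv using he
  have hiff : ∀ a b c, μ.Realize ![a, b, c] ↔ m a b = c := fun a b c =>
    ⟨fun h => huniq _ _ _ _ (hm a b) h, fun h => h ▸ hm a b⟩
  let : Mul K := ⟨m⟩
  let : One K := ⟨e⟩
  let : Inv K := ⟨inv⟩
  exact ⟨Group.ofLeftAxioms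
    (fun a b c => ((hiff _ _ _).mp (hassoc _ _ _ _ _ _ (hm a b) (hm b c) (hm _ c))).symm)
    (fun a => (hiff _ _ _).mp (he1 a)) (fun a => (hiff _ _ _).mp (hinv a)), hiff⟩

end GroupTransfer

end RegularGroups

namespace RegularGroups

/-! ### Strongly regular types: definability in groups and uniform decision -/

namespace GlobalType

variable {L : FirstOrder.Language.{u, v}} {C : Type w} [L.Structure C] (p : GlobalType L C)
  {A B : Set C}

theorem compl_notMem {X : Set C} (h : X ∈ p.sets) : Xᶜ ∉ p.sets := fun h' =>
  p.empty_notMem (by simpa using p.inter_mem _ h _ h')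

theorem compl_mem {X : Set C} (h : B.Definable₁ L X) (hX : X ∉ p.sets) : Xᶜ ∈ p.sets :=
  (p.mem_or_compl_mem X (definable₁_mono h (Set.subset_univ B))).resolve_left hX

theorem nonempty_of_mem {X : Set C} (h : X ∈ p.sets) : X.Nonempty := by
  rw [Set.nonempty_iff_ne_empty]
  rintro rfl
  exact p.empty_notMem h

theorem sInter_mem_restrict {F : Set (Set C)} (hF : F.Finite) (h : F ⊆ p.restrict B) :
    ⋂₀ F ∈ p.restrict B := by
  induction F, hF using Set.Finite.induction_on with
  | empty => simpa using ⟨p.univ_mem, Set.definable_univ⟩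
  | @insert X F _ _ ih =>
    rw [Set.sInter_insert]
    have hX := h (Set.mem_insert _ _)
    have hF := ih ((Set.subset_insert _ _).trans h)
    exact ⟨p.inter_mem _ hX.1 _ hF.1, definable₁_inter hX.2 hF.2⟩

theorem exists_realizes {κ : Cardinal.{w}} (hC : IsSaturated L κ C) (hB : #B < κ) :
    ∃ a, p.Realizes B a :=
  hC B hB (p.restrict B) (fun _ h => h.2) fun _ hF hfin =>
    p.nonempty_of_mem (p.sInter_mem_restrict hfin hF).1

theorem not_realizes {X : Set C} (h : B.Definable₁ L X) (hX : X ∉ p.sets) {x : C} (hx : x ∈ X) :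
    ¬ p.Realizes B x := fun h' =>
  h' Xᶜ ⟨p.compl_mem h hX, definable₁_compl h⟩ hx

variable {p}

theorem IsNonalgebraic.singleton_notMem (hp : p.IsNonalgebraic) (a : C) : {a} ∉ p.sets :=
  fun h => hp _ h (Set.finite_singleton a)

theorem Realizes.singleton_not_definable (hp : p.IsNonalgebraic) {a : C} (h : p.Realizes B a) :
    ¬ B.Definable₁ L {a} := fun h' =>
  p.not_realizes h' (hp.singleton_notMem a) rfl h

namespace IsStronglyRegular

/-- Regularity in the form used for groups: adjoining a non-realization to the parameters costs a
realization nothing. -/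
theorem realizes_insert (hp : p.IsStronglyRegular A) (hAB : A ⊆ B) {x g : C}
    (hx : ¬ p.Realizes B x) (hg : p.Realizes B g) : p.Realizes (insert x B) g := by
  intro Y hY
  obtain ⟨X, hX, hXY⟩ := (hp.regular B hAB x).resolve_left hx Y hY
  exact hXY (hg X hX)

/-- In a group, membership in a strongly regular type is definable without parameters. -/
theorem mem_iff [Group C] {μ : L.Formula (Fin 3)} (hμ : DefinesMul μ C) {κ : Cardinal.{w}}
    (hC : IsMonster L κ C) (hA : #A < κ) (hp : p.IsStronglyRegular A) {X : Set C}
    (hX : (Set.univ : Set C).Definable₁ L X) :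
    X ∈ p.sets ↔ ∀ g : C, ∃ x ∈ X, g * x ∈ X := by
  obtain ⟨F, -, hF⟩ := exists_finset_definable₁ hX
  have small : ∀ E : Set C, E.Finite → #(A ∪ E : Set C) < κ := fun E hE =>
    (mk_union_le _ _).trans_lt
      (add_lt_of_lt hC.aleph0_lt.le hA ((lt_aleph0_iff_set_finite.mpr hE).trans hC.aleph0_lt))
  have hμ' : ∀ f : Fin 3 → C, μ.Realize f ↔ f 0 * f 1 = f 2 := fun f => by
    rw [← hμ]
    exact iff_of_eq (congrArg _ (by ext i; fin_cases i <;> rfl))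
  have hmul : ∀ (E : Set C) {ι : Type} (i j k : ι),
      DefPred L E fun y : ι → C => y i * y j = y k := fun E ι i j k => by
    simpa [hμ'] using DefPred.of_formula (A := E) μ ![i, j, k]
  constructor
  · intro hXp g
    let B : Set C := A ∪ insert g (F : Set C)
    have hAB : A ⊆ B := Set.subset_union_left
    have hgB : g ∈ B := Or.inr (Or.inl rfl)
    have hXB : B.Definable₁ L X :=
      definable₁_mono hF ((Set.subset_insert _ _).trans Set.subset_union_right)
    obtain ⟨a, ha⟩ := p.exists_realizes hC.saturated (small _ (F.finite_toSet.insert g))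
    refine ⟨a, ha X ⟨hXp, hXB⟩, ?_⟩
    suffices h : p.Realizes B (g * a) from h X ⟨hXp, hXB⟩
    -- Otherwise `a` still realizes `p` over `B` and `g * a`, although the equation `g * y = g * a`
    -- defines it there.
    by_contra h
    refine (hp.realizes_insert hAB h ha).singleton_not_definable hp.nonalgebraic ?_
    have h1 : DefPred L (insert (g * a) B) fun y : Fin 1 → C => g * y 0 = g * a :=
      DefPred.subst (R := fun (y : Fin 1 → C) c => c * y 0 = g * a) (Or.inr hgB)
        (DefPred.subst (R := fun (y : Option (Fin 1) → C) c => y none * y (some 0) = c)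
          (Or.inl rfl) (hmul _ (some none) (some (some 0)) none))
    simp only [mul_right_inj] at h1
    exact h1
  · intro h
    by_contra hXp
    let B : Set C := A ∪ F
    have hAB : A ⊆ B := Set.subset_union_left
    have hXB : B.Definable₁ L X := definable₁_mono hF Set.subset_union_right
    obtain ⟨g, hg⟩ := p.exists_realizes hC.saturated (small _ F.finite_toSet)
    -- Neither `x` nor `g * x` realizes `p|_B`, since both lie in `X`. So `g` still realizes `p`
    -- after both are adjoined, although `y * x = g * x` then defines it.
    obtain ⟨x, hx, hgx⟩ := h g
    have h1 := hp.realizes_insert hAB (p.not_realizes hXB hXp hx) hg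
    have h2 := hp.realizes_insert (hAB.trans (Set.subset_insert x B))
      (p.not_realizes (definable₁_mono hXB (Set.subset_insert x B)) hXp hgx) h1
    refine h2.singleton_not_definable hp.nonalgebraic ?_
    have h3 : DefPred L (insert (g * x) (insert x B)) fun y : Fin 1 → C => y 0 * x = g * x :=
      DefPred.subst (R := fun (y : Fin 1 → C) c => y 0 * c = g * x) (Or.inr (Or.inl rfl))
        (DefPred.subst (R := fun (y : Option (Fin 1) → C) c => y (some 0) * y none = c)
          (Or.inl rfl) (hmul _ (some (some 0)) (some none) none))
    simp only [mul_left_inj] at h3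
    exact h3

/-- A single `e` in `X` does not realize `p|_B`, so by regularity some set in `p|_B` decides `R(x,
e)`. Saturation makes the choice uniform: otherwise some `e` in `X` would be undecided by every set
in `p|_B`. -/
theorem exists_decides {κ : Cardinal.{w}} (hC : IsMonster L κ C) (hA : #A < κ)
    (hp : p.IsStronglyRegular A) {X : Set C} (hX : (Set.univ : Set C).Definable₁ L X)
    (hXp : X ∉ p.sets) {R : Set (C × C)} (hR : (Set.univ : Set C).Definable₂ L R) :
    ∃ Y ∈ p.sets, ∀ e ∈ X, (∀ x ∈ Y, (x, e) ∈ R) ∨ ∀ x ∈ Y, (x, e) ∉ R := by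
  obtain ⟨F₁, -, hF₁⟩ := exists_finset_definable₁ hX
  obtain ⟨F₂, -, hF₂⟩ := exists_finset_definable₂ hR
  let B : Set C := A ∪ (F₁ ∪ F₂)
  have hB : #B < κ := (mk_union_le _ _).trans_lt (add_lt_of_lt hC.aleph0_lt.le hA
    ((lt_aleph0_iff_set_finite.mpr (F₁.finite_toSet.union F₂.finite_toSet)).trans hC.aleph0_lt))
  have hAB : A ⊆ B := Set.subset_union_left
  have hXB : B.Definable₁ L X :=
    definable₁_mono hF₁ (Set.subset_union_left.trans Set.subset_union_right)
  have hRB : B.Definable₂ L R :=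
    definable₂_mono hF₂ (Set.subset_union_right.trans Set.subset_union_right)
  let bad : Set C → Set C := fun Y =>
    {e | e ∈ X ∧ ¬ ((∀ x ∈ Y, (x, e) ∈ R) ∨ ∀ x ∈ Y, (x, e) ∉ R)}
  have hbad : ∀ Y, B.Definable₁ L Y → B.Definable₁ L (bad Y) := fun Y hY => by
    refine (DefPred.of_definable₁ hXB (0 : Fin 1)).and (DefPred.not (DefPred.or ?_ ?_))
    · exact DefPred.all (R := fun (y : Fin 1 → C) x => x ∈ Y → (x, y 0) ∈ R)
        ((DefPred.of_definable₁ hY none).imp (DefPred.of_definable₂ hRB none (some 0)))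
    · exact DefPred.all (R := fun (y : Fin 1 → C) x => x ∈ Y → (x, y 0) ∉ R)
        ((DefPred.of_definable₁ hY none).imp (DefPred.of_definable₂ hRB none (some 0)).not)
  have hanti : ∀ Y Z, Y ⊆ Z → bad Y ⊆ bad Z := fun Y Z hYZ e he =>
    ⟨he.1, fun h => he.2 (h.imp (fun h x hx => h x (hYZ hx)) fun h x hx => h x (hYZ hx))⟩
  by_contra hcon
  have hne : ∀ Y ∈ p.sets, (bad Y).Nonempty := fun Y hY => by
    by_contra hemp
    refine hcon ⟨Y, hY, fun e he => ?_⟩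
    by_contra h
    exact hemp ⟨e, he, h⟩
  -- Finite satisfiability: `p|_B` is closed under finite intersections, and a smaller `Y` leaves
  -- fewer elements undecided.
  obtain ⟨e, he⟩ := hC.saturated B hB (bad '' p.restrict B)
    (by rintro _ ⟨Y, hY, rfl⟩; exact hbad Y hY.2) (by
      intro F hF hfin
      obtain ⟨F', hF', hfin', rfl⟩ :=
        Set.exists_subset_image_finite_and.mp ⟨F, hF, hfin, (rfl : F = F)⟩
      refine (hne _ (p.sInter_mem_restrict hfin' hF').1).mono ?_
      rintro x hx _ ⟨Y, hY, rfl⟩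
      exact hanti _ _ (Set.sInter_subset_of_mem hY) hx)
  have he' : ∀ Y ∈ p.restrict B, e ∈ bad Y := fun Y hY => he _ ⟨Y, hY, rfl⟩
  have heX : e ∈ X := (he' _ ⟨p.univ_mem, Set.definable_univ⟩).1
  have hent := (hp.regular B hAB e).resolve_left (p.not_realizes hXB hXp heX)
  have hfib : (insert e B).Definable₁ L {x | (x, e) ∈ R} :=
    definable₁_fiber (definable₂_mono hRB (Set.subset_insert e B)) (Set.mem_insert e B)
  by_cases hmem : {x | (x, e) ∈ R} ∈ p.sets
  · obtain ⟨Y, hY, hYR⟩ := hent _ ⟨hmem, hfib⟩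
    exact (he' Y hY).2 (Or.inl fun x hx => hYR hx)
  · obtain ⟨Y, hY, hYR⟩ := hent _ ⟨p.compl_mem hfib hmem, definable₁_compl hfib⟩
    exact (he' Y hY).2 (Or.inr fun x hx => hYR hx)

end IsStronglyRegular

end GlobalType

end RegularGroups

/-! ### Countable extensions that add nothing to `cl M` -/

namespace RegularGroups

variable {L : FirstOrder.Language.{u, v}} {C : Type w} [L.Structure C]

theorem exists_definable₁_of_sUnion {c : Set (Set C)} (hc : c.Nonempty)
    (hdir : DirectedOn (· ⊆ ·) c) {D : Set C} (hD : (⋃₀ c).Definable₁ L D) :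
    ∃ S ∈ c, S.Definable₁ L D := by
  obtain ⟨F, hF, hFD⟩ := exists_finset_definable₁ hD
  obtain ⟨S, hS, hFS⟩ :=
    hdir.exists_mem_subset_of_finite_of_subset_sUnion hc F.finite_toSet hF
  exact ⟨S, hS, definable₁_mono hFD hFS⟩

theorem exists_definable₁_of_iUnion {S : ℕ → Set C} (hS : Monotone S) {D : Set C}
    (hD : (⋃ n, S n).Definable₁ L D) : ∃ n, (S n).Definable₁ L D := by
  obtain ⟨_, ⟨n, rfl⟩, h⟩ := exists_definable₁_of_sUnion (Set.range_nonempty S)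
    (directedOn_range.mpr hS.directed_le) hD
  exact ⟨n, h⟩

/-- Countable saturation for decreasing sequences. -/
theorem IsMonster.exists_mem_of_antitone {κ : Cardinal.{w}} (hC : IsMonster L κ C) {B : Set C}
    (hB : B.Countable) {D : ℕ → Set C} (hD : ∀ n, B.Definable₁ L (D n)) (hanti : Antitone D)
    (hne : ∀ n, (D n).Nonempty) : ∃ x, ∀ n, x ∈ D n := by
  obtain ⟨x, hx⟩ := hC.saturated B (hB.le_aleph0.trans_lt hC.aleph0_lt) (Set.range D)
    (by rintro _ ⟨n, rfl⟩; exact hD n) (by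
      intro F hF hfin
      rw [← Set.image_univ] at hF
      obtain ⟨t, -, ht, rfl⟩ :=
        Set.exists_subset_image_finite_and.mp ⟨F, hF, hfin, (rfl : F = F)⟩
      obtain ⟨N, hN⟩ := ht.bddAbove
      refine (hne N).mono ?_
      rintro x hx _ ⟨n, hn, rfl⟩
      exact hanti (hN hn) hx)
  exact ⟨x, fun n => hx _ ⟨n, rfl⟩⟩

namespace GlobalType

variable (p : GlobalType L C)

/-- The union of the `M`-definable sets that do not belong to `p`. -/
def cl (M : Set C) : Set C :=
  {e | ∃ X, M.Definable₁ L X ∧ X ∉ p.sets ∧ e ∈ X}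

/-- Every `S`-definable set that meets `cl M` already meets `M`. -/
def ClConservative (M S : Set C) : Prop :=
  ∀ D, S.Definable₁ L D → (D ∩ p.cl M).Nonempty → (D ∩ M).Nonempty

/-- Over `M`, the type `p` decides every definable family with parameters from `cl M`. -/
def DecidesOver (M : Set C) : Prop :=
  ∀ X, M.Definable₁ L X → X ∉ p.sets → ∀ R, M.Definable₂ L R →
    ∃ Y ∈ p.restrict M, ∀ e ∈ X, (∀ x ∈ Y, (x, e) ∈ R) ∨ ∀ x ∈ Y, (x, e) ∉ R

variable {p} {M S : Set C}

theorem cl_mono (h : M ⊆ S) : p.cl M ⊆ p.cl S := fun _ ⟨X, hX, hXp, he⟩ =>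
  ⟨X, definable₁_mono hX h, hXp, he⟩

/-- Apply conservativity to singletons of elements of `S`. -/
theorem ClConservative.inter_cl_subset (h : p.ClConservative M S) : S ∩ p.cl M ⊆ M := by
  rintro e ⟨heS, he⟩
  obtain ⟨x, rfl, hx⟩ := h {e} (Set.Definable.singleton_of_mem L heS) ⟨e, rfl, he⟩
  exact hx

theorem ClConservative.insert_of_realizes (hM : L.MeetsDefinable M) (hdec : p.DecidesOver M)
    {a : C} (ha : p.Realizes M a) : p.ClConservative M (insert a M) := by
  rintro D hD ⟨e, heD, X, hX, hXp, heX⟩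
  obtain ⟨T, hT, rfl⟩ := exists_fiber hD
  let R : Set (C × C) := {q | (q.2, q.1) ∈ T}
  have hR : M.Definable₂ L R := DefPred.of_definable₂ hT (1 : Fin 2) 0
  obtain ⟨Y, hY, hYR⟩ := hdec X hX hXp R hR
  -- Since `a` lies in `Y` and is related to `e`, the decision made by `Y` is positive. This
  -- replaces the condition on `a` by a condition over `M`, which then has a solution in `M`.
  have hne : ∀ x ∈ Y, (x, e) ∈ R :=
    (hYR e heX).resolve_right fun h => h a (ha Y hY) heD
  let E : Set C := {z | z ∈ X ∧ ∀ x, x ∈ Y → (x, z) ∈ R}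
  have hE : M.Definable₁ L E :=
    (DefPred.of_definable₁ hX (0 : Fin 1)).and
      (DefPred.all (R := fun (y : Fin 1 → C) x => x ∈ Y → (x, y 0) ∈ R)
        ((DefPred.of_definable₁ hY.2 none).imp (DefPred.of_definable₂ hR none (some 0))))
  obtain ⟨m, hm, hmM⟩ := hM E ⟨e, heX, hne⟩ hE
  exact ⟨m, hm.2 a (ha Y hY), hmM⟩

theorem ClConservative.iUnion {S : ℕ → Set C} (hS : Monotone S)
    (h : ∀ n, p.ClConservative M (S n)) : p.ClConservative M (⋃ n, S n) := fun D hD => by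
  obtain ⟨n, hn⟩ := exists_definable₁_of_iUnion hS hD
  exact h n D hn

/-- One omitting-types step. For `x` in `D'`, the fiber `R(x, ·)` either misses `X` or contains a
point of `M`, so it cannot meet `cl M` inside `X` without meeting `M`. -/
theorem ClConservative.exists_refinement (h : p.ClConservative M S) (hMS : M ⊆ S) {D X : Set C}
    {R : Set (C × C)} (hD : S.Definable₁ L D) (hne : D.Nonempty) (hX : M.Definable₁ L X)
    (hXp : X ∉ p.sets) (hR : S.Definable₂ L R) :
    ∃ D' ⊆ D, S.Definable₁ L D' ∧ D'.Nonempty ∧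
      ((∀ x ∈ D', ∀ y ∈ X, (x, y) ∉ R) ∨ ∃ m ∈ M, ∀ x ∈ D', (x, m) ∈ R) := by
  let E : Set C := {y | y ∈ X ∧ ∃ x, x ∈ D ∧ (x, y) ∈ R}
  have hE : S.Definable₁ L E :=
    (DefPred.of_definable₁ (definable₁_mono hX hMS) (0 : Fin 1)).and
      (DefPred.ex (R := fun (z : Fin 1 → C) x => x ∈ D ∧ (x, z 0) ∈ R)
        ((DefPred.of_definable₁ hD none).and (DefPred.of_definable₂ hR none (some 0))))
  by_cases hEne : E.Nonempty
  · obtain ⟨y, hy⟩ := hEne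
    obtain ⟨m, ⟨-, x, hx⟩, hmM⟩ := h E hE ⟨y, hy, X, hX, hXp, hy.1⟩
    exact ⟨D ∩ {x | (x, m) ∈ R}, Set.inter_subset_left,
      definable₁_inter hD (definable₁_fiber hR (hMS hmM)), ⟨x, hx⟩, Or.inr ⟨m, hmM, fun _ h => h.2⟩⟩
  · exact ⟨D, subset_rfl, hD, hne, Or.inl fun x hx y hy hxy => hEne ⟨y, hy, x, hx, hxy⟩⟩

/-- There are only countably many pairs `(X, R)` to treat. Refining `D` once for each yields a
decreasing sequence of nonempty sets, and saturation supplies a common point. -/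
theorem ClConservative.exists_insert [Countable L.Symbols] {κ : Cardinal.{w}}
    (hC : IsMonster L κ C) (h : p.ClConservative M S) (hMS : M ⊆ S) (hS : S.Countable) {D : Set C}
    (hD : S.Definable₁ L D) (hne : D.Nonempty) :
    ∃ x ∈ D, p.ClConservative M (insert x S) := by
  let T := {X : Set C // M.Definable₁ L X ∧ X ∉ p.sets} × {R : Set (C × C) // S.Definable₂ L R}
  have : Countable {X : Set C // M.Definable₁ L X ∧ X ∉ p.sets} :=
    ((countable_setOf_definable₁ (hS.mono hMS)).mono fun _ h => h.1).to_subtype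
  have : Countable {R : Set (C × C) // S.Definable₂ L R} :=
    (countable_setOf_definable₂ hS).to_subtype
  have : Nonempty T := ⟨⟨∅, Set.definable_empty, p.empty_notMem⟩, ⟨∅, Set.definable_empty⟩⟩
  obtain ⟨t, ht⟩ := exists_surjective_nat T
  let Q := {D : Set C // S.Definable₁ L D ∧ D.Nonempty}
  have hstep : ∀ (n : ℕ) (D : Q), ∃ D' : Q, D'.1 ⊆ D.1 ∧
      ((∀ x ∈ D'.1, ∀ y ∈ (t n).1.1, (x, y) ∉ (t n).2.1) ∨
        ∃ m ∈ M, ∀ x ∈ D'.1, (x, m) ∈ (t n).2.1) := fun n D => by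
    obtain ⟨D', h1, h2, h3, h4⟩ := h.exists_refinement hMS D.2.1 D.2.2 (t n).1.2.1 (t n).1.2.2
      (t n).2.2
    exact ⟨⟨D', h2, h3⟩, h1, h4⟩
  choose f hf hf' using hstep
  let Ds : ℕ → Q := fun n => Nat.rec ⟨D, hD, hne⟩ f n
  obtain ⟨x, hx⟩ := hC.exists_mem_of_antitone hS (fun n => (Ds n).2.1)
    (antitone_nat_of_succ_le fun n => hf n (Ds n)) fun n => (Ds n).2.2
  refine ⟨x, hx 0, ?_⟩
  rintro E hE ⟨e, heE, X, hX, hXp, heX⟩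
  obtain ⟨R, hR, rfl⟩ := exists_fiber hE
  let R' : Set (C × C) := {q | (q.2, q.1) ∈ R}
  have hR' : S.Definable₂ L R' := DefPred.of_definable₂ hR (1 : Fin 2) 0
  -- The pair with index `n` is treated in passing from `Ds n` to `Ds (n + 1)`, hence the use of `hx
  -- (n + 1)` below.
  obtain ⟨n, hn⟩ := ht ⟨⟨X, hX, hXp⟩, ⟨R', hR'⟩⟩
  have := hf' n (Ds n)
  rw [hn] at this
  rcases this with h1 | ⟨m, hm, h1⟩
  · exact absurd heE (h1 x (hx (n + 1)) e heX)
  · exact ⟨m, h1 x (hx (n + 1)), hm⟩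

theorem ClConservative.exists_witnesses [Countable L.Symbols] {κ : Cardinal.{w}}
    (hC : IsMonster L κ C) (h : p.ClConservative M S) (hMS : M ⊆ S) (hS : S.Countable) :
    ∃ S' : Set C, S ⊆ S' ∧ S'.Countable ∧ p.ClConservative M S' ∧
      ∀ D, S.Definable₁ L D → D.Nonempty → (D ∩ S').Nonempty := by
  let T := {D : Set C // S.Definable₁ L D ∧ D.Nonempty}
  rcases isEmpty_or_nonempty C with hC0 | hC0
  · exact ⟨S, subset_rfl, hS, h, fun D _ hne => (hC0.false hne.some).elim⟩
  have : Countable T :=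
    ((countable_setOf_definable₁ hS).mono fun _ h => h.1).to_subtype
  have : Nonempty T := ⟨⟨Set.univ, Set.definable_univ, Set.univ_nonempty⟩⟩
  obtain ⟨t, ht⟩ := exists_surjective_nat T
  let Q := {S' : Set C // S ⊆ S' ∧ S'.Countable ∧ p.ClConservative M S'}
  have hstep : ∀ (n : ℕ) (S' : Q), ∃ S'' : Q, S'.1 ⊆ S''.1 ∧ ((t n).1 ∩ S''.1).Nonempty :=
    fun n S' => by
      obtain ⟨x, hx, hxc⟩ := S'.2.2.2.exists_insert hC (hMS.trans S'.2.1) S'.2.2.1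
        (definable₁_mono (t n).2.1 S'.2.1) (t n).2.2
      exact ⟨⟨insert x S'.1, S'.2.1.trans (Set.subset_insert _ _), S'.2.2.1.insert x, hxc⟩,
        Set.subset_insert _ _, x, hx, Set.mem_insert _ _⟩
  choose f hf hf' using hstep
  let s : ℕ → Q := fun n => Nat.rec ⟨S, subset_rfl, hS, h⟩ f n
  refine ⟨⋃ n, (s n).1, Set.subset_iUnion (fun n => (s n).1) 0,
    Set.countable_iUnion fun n => (s n).2.2.1,
    ClConservative.iUnion (monotone_nat_of_le_succ fun n => hf n (s n)) fun n => (s n).2.2.2, ?_⟩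
  intro D hD hne
  obtain ⟨n, hn⟩ := ht ⟨D, hD, hne⟩
  have := hf' n (s n)
  rw [hn] at this
  exact this.mono (Set.inter_subset_inter_right _ (Set.subset_iUnion (fun n => (s n).1) (n + 1)))

/-- `exists_witnesses` serves only the sets definable over the old parameters. Iterating it `ω`
times suffices, because a definition uses finitely many parameters. -/
theorem ClConservative.exists_meetsDefinable [Countable L.Symbols] {κ : Cardinal.{w}}
    (hC : IsMonster L κ C) (h : p.ClConservative M S) (hMS : M ⊆ S) (hS : S.Countable) :
    ∃ N : Set C, S ⊆ N ∧ N.Countable ∧ p.ClConservative M N ∧ L.MeetsDefinable N := by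
  let Q := {S' : Set C // S ⊆ S' ∧ S'.Countable ∧ p.ClConservative M S'}
  have hstep : ∀ S' : Q, ∃ S'' : Q, S'.1 ⊆ S''.1 ∧
      ∀ D, S'.1.Definable₁ L D → D.Nonempty → (D ∩ S''.1).Nonempty := fun S' => by
    obtain ⟨S'', h1, h2, h3, h4⟩ := S'.2.2.2.exists_witnesses hC (hMS.trans S'.2.1) S'.2.2.1
    exact ⟨⟨S'', S'.2.1.trans h1, h2, h3⟩, h1, h4⟩
  choose f hf hf' using hstep
  let s : ℕ → Q := fun n => Nat.rec ⟨S, subset_rfl, hS, h⟩ (fun _ => f) n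
  have hmono : Monotone fun n => (s n).1 := monotone_nat_of_le_succ fun n => hf (s n)
  refine ⟨⋃ n, (s n).1, Set.subset_iUnion (fun n => (s n).1) 0,
    Set.countable_iUnion fun n => (s n).2.2.1,
    ClConservative.iUnion hmono fun n => (s n).2.2.2, fun D hne hD => ?_⟩
  obtain ⟨n, hn⟩ := exists_definable₁_of_iUnion hmono hD
  exact (hf' (s n) D hn hne).mono
    (Set.inter_subset_inter_right _ (Set.subset_iUnion (fun n => (s n).1) (n + 1)))

/-- Proper countable extensions that add no new element to `cl M`. -/
theorem exists_extension [Countable L.Symbols] {κ : Cardinal.{w}} (hC : IsMonster L κ C)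
    (hp : p.IsNonalgebraic) (hMc : M.Countable) (hM : L.MeetsDefinable M)
    (hdec : p.DecidesOver M) :
    ∃ N : Set C, M ⊆ N ∧ N.Countable ∧ L.MeetsDefinable N ∧ N ∩ p.cl M ⊆ M ∧ ¬ N ⊆ M := by
  obtain ⟨a, ha⟩ := p.exists_realizes hC.saturated
    (hMc.le_aleph0.trans_lt hC.aleph0_lt)
  obtain ⟨N, h1, h2, h3, h4⟩ := (ClConservative.insert_of_realizes hM hdec ha).exists_meetsDefinable
    hC (Set.subset_insert a M) (hMc.insert a)
  refine ⟨N, (Set.subset_insert a M).trans h1, h2, h4, h3.inter_cl_subset, fun hNM => ?_⟩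
  exact ha.singleton_not_definable hp
    (Set.Definable.singleton_of_mem L (hNM (h1 (Set.mem_insert a M))))

end GlobalType

end RegularGroups

/-! ### The maximal chain and its quasiminimal union -/

namespace RegularGroups

variable {L : FirstOrder.Language.{u, v}} {C : Type w} [L.Structure C]

namespace GlobalType

variable {p : GlobalType L C}

theorem IsStronglyRegular.decidesOver [Group C] {μ : L.Formula (Fin 3)} (hμ : DefinesMul μ C)
    {κ : Cardinal.{w}} (hC : IsMonster L κ C) {A : Set C} (hA : #A < κ)
    (hp : p.IsStronglyRegular A) {M : Set C} (hM : L.MeetsDefinable M) : p.DecidesOver M := by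
  intro X hX hXp R hR
  obtain ⟨Y, hY, hYR⟩ := hp.exists_decides hC hA (definable₁_mono hX (Set.subset_univ M)) hXp
    (definable₂_mono hR (Set.subset_univ M))
  obtain ⟨F, -, hF⟩ := exists_finset_definable₁ (p.definable Y hY)
  obtain ⟨φ, hφ⟩ := Set.definable_iff_exists_formula_sum.mp hF
  let T : (↥(F : Set C) → C) → C → Prop := fun w x => φ.Realize (Sum.elim w fun _ => x)
  have hYT : ∀ x, x ∈ Y ↔ T (fun a => a) x := fun x => Set.ext_iff.mp hφ fun _ => x
  have hT : ∀ {ι : Type w} (f : ↥(F : Set C) → ι) (i : ι),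
      DefPred L M fun y : ι → C => T (y ∘ f) (y i) := fun f i => by
    have h := DefPred.of_formula (A := M) φ (Sum.elim f fun _ => i)
    simp only [Sum.comp_elim] at h
    exact h
  have hmul : ∀ {ι : Type w} (i j k : ι), DefPred L M fun y : ι → C => y i * y j = y k :=
    fun i j k => by
      have h := DefPred.of_formula (A := M) μ ![i, j, k]
      have h' : ∀ f : Fin 3 → C, μ.Realize f ↔ f 0 * f 1 = f 2 := fun f => by
        rw [← hμ]
        exact iff_of_eq (congrArg _ (by ext i; fin_cases i <;> rfl))
      simpa [h'] using h
  -- The condition on `w` that the set it defines lies in `p`, expressed through `mem_iff`, and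
  -- decides `R` on all of `X`. It is definable over `M` and the original parameters of `Y` satisfy
  -- it, so some tuple from `M` does too.
  have hdef : DefPred L M fun w : ↥(F : Set C) → C =>
      (∀ g, ∃ x, ∃ z, g * x = z ∧ T w x ∧ T w z) ∧
        ∀ e, e ∈ X → (∀ x, T w x → (x, e) ∈ R) ∨ ∀ x, T w x → (x, e) ∉ R := by
    refine DefPred.and ?_ ?_
    · refine DefPred.all (DefPred.ex (R := fun (y : Option ↥(F : Set C) → C) x =>
        ∃ z, y none * x = z ∧ T (y ∘ some) x ∧ T (y ∘ some) z) (DefPred.ex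
        (R := fun (y : Option (Option (F : Set C)) → C) z => y (some none) * y none = z ∧
          T (y ∘ some ∘ some) (y none) ∧ T (y ∘ some ∘ some) z) ?_))
      exact (hmul (some (some none)) (some none) none).and
        ((hT (some ∘ some ∘ some) (some none)).and (hT (some ∘ some ∘ some) none))
    · refine DefPred.all ((DefPred.of_definable₁ hX none).imp (DefPred.or
        (DefPred.all (R := fun (y : Option ↥(F : Set C) → C) x =>
          T (y ∘ some) x → (x, y none) ∈ R) ?_)
        (DefPred.all (R := fun (y : Option ↥(F : Set C) → C) x =>
          T (y ∘ some) x → (x, y none) ∉ R) ?_)))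
      · exact (hT (some ∘ some) none).imp (DefPred.of_definable₂ hR none (some none))
      · exact (hT (some ∘ some) none).imp (DefPred.of_definable₂ hR none (some none)).not
  obtain ⟨w, hwM, hw1, hw2⟩ := meetsDefinable_tuple hM hdef ⟨fun a => a, fun g => by
      obtain ⟨x, hx, hgx⟩ := (hp.mem_iff hμ hC hA (p.definable Y hY)).mp hY g
      exact ⟨x, g * x, rfl, (hYT _).mp hx, (hYT _).mp hgx⟩, by simpa only [hYT] using hYR⟩
  have hY' : M.Definable₁ L {x | T w x} := by
    refine Set.definable_iff_exists_formula_sum.mpr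
      ⟨φ.relabel (Sum.elim (fun a => Sum.inl ⟨w a, hwM a⟩) Sum.inr), ?_⟩
    ext x
    simp only [Set.mem_ofPred_eq, Language.Formula.realize_relabel, T]
    refine iff_of_eq (congrArg _ ?_)
    ext (a | i)
    · rfl
    · rw [Subsingleton.elim i 0]
      rfl
  refine ⟨{x | T w x}, ⟨?_, hY'⟩, hw2⟩
  rw [hp.mem_iff hμ hC hA (definable₁_mono hY' (Set.subset_univ M))]
  intro g
  obtain ⟨x, z, rfl, hx, hz⟩ := hw1 g
  exact ⟨x, hx, hz⟩

theorem exists_uncountable_meetsDefinable [Countable L.Symbols] {κ : Cardinal.{w}}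
    (hC : IsMonster L κ C) (hp : p.IsNonalgebraic)
    (hdec : ∀ M : Set C, L.MeetsDefinable M → p.DecidesOver M) :
    ∃ H : Set C, L.MeetsDefinable H ∧ ¬ H.Countable ∧
      ∀ X, H.Definable₁ L X → (X ∩ H).Countable ∨ (Xᶜ ∩ H).Countable := by
  let Q := {M : Set C // M.Countable ∧ L.MeetsDefinable M}
  let r : Q → Q → Prop := fun M N => M.1 ⊆ N.1 ∧ N.1 ∩ p.cl M.1 ⊆ M.1
  obtain ⟨c, hc⟩ : ∃ c, IsMaxChain r c := ⟨_, maxChain_spec⟩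
  -- Downward Löwenheim–Skolem; this keeps the maximal chain from being empty.
  have hQ : Nonempty Q := by
    have : Infinite C := Set.infinite_univ_iff.mp (hp _ p.univ_mem)
    have hL : L.card ≤ ℵ₀ := mk_le_aleph0
    obtain ⟨S, -, hS⟩ := Language.exists_elementarySubstructure_card_eq L (M := C) ∅
      (ℵ₀ : Cardinal.{w}) le_rfl (by simp) (by simpa using hL) (by simp)
    exact ⟨S, by simpa using hS.le, S.meetsDefinable⟩
  have hcne : c.Nonempty := by
    rw [Set.nonempty_iff_ne_empty]
    rintro rfl
    have := hc.2 (t := {hQ.some}) (by simp) (Set.empty_subset _)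
    exact Set.singleton_ne_empty _ this.symm
  let H : Set C := ⋃₀ (Subtype.val '' c)
  have hsub : ∀ M ∈ c, M.1 ⊆ H := fun M hM => Set.subset_sUnion_of_mem ⟨M, hM, rfl⟩
  have htot : ∀ M ∈ c, ∀ N ∈ c, N.1 ⊆ M.1 ∨ r M N := fun M hM N hN => by
    by_cases hMN : M = N
    · exact Or.inl hMN.ge
    · exact (hc.1 hM hN hMN).symm.imp_left And.left
  -- No later stage of the chain adds a point to `cl M`; this is what keeps the sets outside `p`
  -- countable in `H`.
  have hcl : ∀ M ∈ c, H ∩ p.cl M.1 ⊆ M.1 := by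
    rintro M hM e ⟨⟨_, ⟨N, hN, rfl⟩, heN⟩, he⟩
    rcases htot M hM N hN with h | h
    · exact h heN
    · exact h.2 ⟨heN, he⟩
  have hdef : ∀ D, H.Definable₁ L D → ∃ M ∈ c, M.1.Definable₁ L D := fun D hD => by
    obtain ⟨_, ⟨M, hM, rfl⟩, h⟩ := exists_definable₁_of_sUnion (hcne.image _) (by
      rintro _ ⟨M, hM, rfl⟩ _ ⟨N, hN, rfl⟩
      rcases htot M hM N hN with h | h
      · exact ⟨M.1, ⟨M, hM, rfl⟩, subset_rfl, h⟩
      · exact ⟨N.1, ⟨N, hN, rfl⟩, h.1, subset_rfl⟩) hD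
    exact ⟨M, hM, h⟩
  have hH : L.MeetsDefinable H := fun D hne hD => by
    obtain ⟨M, hM, h⟩ := hdef D hD
    exact (M.2.2 D hne h).mono (Set.inter_subset_inter_right _ (hsub M hM))
  have hsmall : ∀ X, H.Definable₁ L X → X ∉ p.sets → (X ∩ H).Countable := fun X hX hXp => by
    obtain ⟨M, hM, h⟩ := hdef X hX
    exact M.2.1.mono fun e he => hcl M hM ⟨he.2, X, h, hXp, he.1⟩
  refine ⟨H, hH, fun hHc => ?_, fun X hX => ?_⟩
  -- A countable `H` has a proper extension `N`. A point of `N` in `cl M` lies in `cl H`, hence in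
  -- `H`, hence in `M`; so `N` can be added on top of the chain, against maximality.
  · obtain ⟨N, hHN, hNc, hN, hNcl, hNH⟩ := exists_extension hC hp hHc hH (hdec H hH)
    have hchain : IsChain r (insert (⟨N, hNc, hN⟩ : Q) c) :=
      hc.1.insert fun M hM _ => Or.inr ⟨(hsub M hM).trans hHN, fun e he =>
        hcl M hM ⟨hNcl ⟨he.1, cl_mono (hsub M hM) he.2⟩, he.2⟩⟩
    have hmem : (⟨N, hNc, hN⟩ : Q) ∈ c :=
      hc.2 hchain (Set.subset_insert _ _) ▸ Set.mem_insert _ _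
    exact hNH (hsub _ hmem)
  · by_cases hXp : X ∈ p.sets
    · exact Or.inr (hsmall _ (definable₁_compl hX) (p.compl_notMem hXp))
    · exact Or.inl (hsmall _ hX hXp)

end GlobalType

/-! ### Passage to a model in the universe of `G` -/

theorem isQuasiminimal_of_elementaryEmbedding {K : Type w'} [L.Structure K] [Uncountable K]
    (f : K ↪ₑ[L] C) {H : Set C} (hf : ∀ x, f x ∈ H)
    (hH : ∀ X, H.Definable₁ L X → (X ∩ H).Countable ∨ (Xᶜ ∩ H).Countable) :
    IsQuasiminimal L K := by
  refine ⟨inferInstance, fun X hX => ?_⟩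
  obtain ⟨φ, hφ⟩ := Set.definable_iff_exists_formula_sum.mp hX
  let D : Set C := {y | φ.Realize (Sum.elim (fun a : (Set.univ : Set K) => f a) fun _ => y)}
  have hD : H.Definable₁ L D := by
    refine Set.definable_iff_exists_formula_sum.mpr
      ⟨φ.relabel (Sum.elim (fun a : (Set.univ : Set K) => Sum.inl ⟨f a, hf a⟩) Sum.inr), ?_⟩
    ext x
    simp only [Set.mem_ofPred_eq, Language.Formula.realize_relabel, D]
    refine iff_of_eq (congrArg _ ?_)
    ext (a | i)
    · rfl
    · rw [Subsingleton.elim i 0]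
      rfl
  have hXD : ∀ x, x ∈ X ↔ f x ∈ D := fun x => by
    refine (Set.ext_iff.mp hφ fun _ => x).trans ?_
    simp only [Set.mem_ofPred_eq, D]
    rw [← f.map_formula]
    refine iff_of_eq (congrArg _ ?_)
    ext (a | i) <;> rfl
  refine (hH D hD).imp (fun h => ?_) fun h => ?_
  · exact (h.preimage f.injective).mono fun x hx => Set.mem_inter ((hXD x).mp hx) (hf x)
  · exact (h.preimage f.injective).mono fun x hx =>
      Set.mem_inter (fun h => hx ((hXD x).mpr h)) (hf x)

/-- An uncountable structure for a countable language has an elementary substructure of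
cardinality `ℵ₁`, of which there is a copy in every universe. -/
theorem exists_elementaryEmbedding_of_uncountable [Countable L.Symbols] [Uncountable C] :
    ∃ (K : Type w') (_ : L.Structure K) (_ : K ↪ₑ[L] C), Uncountable K := by
  obtain ⟨S, -, hS⟩ := Language.exists_elementarySubstructure_card_eq L (M := C) ∅
    (ℵ_ 1 : Cardinal.{w'}) (aleph0_le_aleph 1) (by simp) (by
      rw [lift_aleph]
      exact (lift_le_aleph0.mpr (mk_le_aleph0 : #L.Symbols ≤ ℵ₀)).trans (aleph0_le_aleph _)) (by
      rw [lift_aleph, Ordinal.lift_one, ← succ_aleph0, Order.succ_le_iff, aleph0_lt_lift]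
      exact aleph0_lt_mk)
  rw [← mk_out (ℵ_ 1 : Cardinal.{w'}), lift_mk_eq'] at hS
  obtain ⟨e⟩ := hS
  let _ := e.inducedStructure (L := L)
  refine ⟨_, e.inducedStructure, S.subtype.comp
    (Equiv.inducedStructureEquiv e).symm.toElementaryEmbedding, ?_⟩
  rw [← aleph0_lt_mk_iff, mk_out]
  exact aleph0_lt_aleph_one

end RegularGroups

theorem corollary3p4 {L : FirstOrder.Language.{u, v}} [Countable L.Symbols]
    {G : Type w} [Group G] [L.Structure G]
    (μ : L.Formula (Fin 3)) (hμ : RegularGroups.DefinesMul μ G)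
    {κ : Cardinal.{w'}} {C : Type w'} [L.Structure C] (hGC : L.ElementarilyEquivalent G C)
    (hC : RegularGroups.IsMonster L κ C)
    (hreg : RegularGroups.CarriesStronglyRegularType L κ C) :
    ∃ (H : Type w) (_ : Group H) (_ : L.Structure H),
      RegularGroups.DefinesMul μ H ∧ L.ElementarilyEquivalent G H ∧
        RegularGroups.IsQuasiminimal L H := by
  obtain ⟨p, A, hA, hp⟩ := hreg
  obtain ⟨_, hμC⟩ := RegularGroups.exists_group_of_elementarilyEquivalent hμ hGC
  obtain ⟨H, hH, hHunc, hHdef⟩ := RegularGroups.GlobalType.exists_uncountable_meetsDefinable hC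
    hp.nonalgebraic fun _ hM => hp.decidesOver hμC hC hA hM
  let S := hH.toElementarySubstructure
  have hS : (S : Set C) = H := hH.closure_eq_self
  have : Uncountable S := by
    rw [← not_countable_iff]
    intro h
    exact hHunc (hS ▸ Set.countable_coe_iff.mp h)
  -- `S` lives in the universe of the monster. A copy of an elementary substructure of size `ℵ₁`
  -- lives in that of `G`, and quasiminimality passes to any uncountable elementary substructure.
  obtain ⟨K, instK, f, hK⟩ :=
    RegularGroups.exists_elementaryEmbedding_of_uncountable.{u, v, w', w} (L := L) (C := S)
  let f' : K ↪ₑ[L] C := S.subtype.comp f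
  have hGK : L.ElementarilyEquivalent G K := hGC.trans f'.elementarilyEquivalent.symm
  obtain ⟨instG, hμK⟩ := RegularGroups.exists_group_of_elementarilyEquivalent hμ hGK
  exact ⟨K, instG, instK, hμK, hGK, RegularGroups.isQuasiminimal_of_elementaryEmbedding f'
    (fun x => hS ▸ (f x).2) hHdef⟩
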